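/- Let $\Omega$ be the set of atoms of a (finite or infinite) partition $\mathcal{P}$ of the sure event; events are the subsets of $\Omega$. Let $P_0$ be a (finitely additive) probability on all events, let $b>0$ and $a\le 0$ be real numbers with $0\le a+b\le 1$, and put $c=1-(a+b)$. The Vertical Barrier Model (VBM) $(\underline{P},\overline{P})$ with these parameters is $$\underline{P}(A)=\max\{bP_0(A)+a,0\}\ (A\neq\Omega),\quad \underline{P}(\Omega)=1,\qquad \overline{P}(A)=\min\{bP_0(A)+c,1\}\ (A\neq\emptyset),\quad \overline{P}(\emptyset)=0.$$ For events $A$ and $B\neq\emptyset$, the natural extensions are $\underline{E}(A|B)=\inf P(A|B)$ and $\overline{E}(A|B)=\sup P(A|B)$, over all conditional probabilities $P$ on the events $E$ and the conditional events $E|B$ such that $P(E)\ge\underline{P}(E)$ for every event $E$; here a conditional probability consists of finitely additive probabilities $P(\cdot)$ and $P(\cdot|B)$ on the events with $P(B|B)=1$ and $P(E\wedge B)=P(E|B)P(B)$ for every $E$ (so $P(\cdot|B)$ is defined even if $P(B)=0$). A partition $\mathfrak{B}$ of $\Omega$ into non-empty events weakly dilates $A$ if $\underline{E}(A|B)\le\underline{P}(A)\le\overline{P}(A)\le\overline{E}(A|B)$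 for every $B\in\mathfrak{B}$. An event $A$ is extreme if $\underline{P}(A)=\overline{P}(A)=0$ or $\underline{P}(A)=\overline{P}(A)=1$. **Theorem.** Given a VBM $(\underline{P},\overline{P})$, let $\mathfrak{B}$ be a finite partition of $\Omega$ into non-empty events, with $|\mathfrak{B}|\ge 3$, that weakly dilates a non-extreme event $A$, and such that $\underline{P}(B)>0$ for all $B\in\mathfrak{B}$. Suppose that both of the following hold: (a) $\underline{P}(A)=0$, or $\underline{P}(A\wedge B)>0$ and $\overline{P}(\neg A\wedge B)>0$ for all $B\in\mathfrak{B}$; (b) $\overline{P}(A)=1$, or $\underline{P}(\neg A\wedge B)>0$ and $\overline{P}(A\wedge B)>0$ for all $B\in\mathfrak{B}$. Then there is a partition $\mathfrak{B}'$ of $\Omega$ into non-empty events, coarser than $\mathfrak{B}$, with $\mathfrak{B}'\neq\mathfrak{B}$ and $\mathfrak{B}'\neq\{\Omega\}$, that weakly dilates $A$. -/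

import Mathlib

/-- A (precise, finitely additive) probability on all events over a space `Ω` of atoms; an event is
a set of atoms. -/
structure FinAddProb (Ω : Type*) where
  /-- the probability of an event -/
  prob : Set Ω → ℝ
  nonneg : ∀ E, 0 ≤ prob E
  univ_eq_one : prob Set.univ = 1
  add_of_disjoint : ∀ E F, Disjoint E F → prob (E ∪ F) = prob E + prob F

/-- The data of a Vertical Barrier Model: a probability `P₀` and parameters `a`, `b`. -/
structure VBM (Ω : Type*) where
  /-- the reference probability -/
  P₀ : FinAddProb Ω
  /-- the additive parameter of the lower probability -/
  a : ℝ
  /-- the slope -/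
  b : ℝ
  b_pos : 0 < b
  a_nonpos : a ≤ 0
  add_nonneg : 0 ≤ a + b
  add_le_one : a + b ≤ 1

namespace VBM

variable {Ω : Type*} (M : VBM Ω)

/-- The additive parameter `c = 1 - (a + b)` of the upper probability. -/
def c : ℝ := 1 - (M.a + M.b)

open Classical in
/-- The lower probability of the model. -/
noncomputable def lower (A : Set Ω) : ℝ :=
  if A = Set.univ then 1 else max (M.b * M.P₀.prob A + M.a) 0

open Classical in
/-- The upper probability of the model. -/
noncomputable def upper (A : Set Ω) : ℝ :=
  if A = ∅ then 0 else min (M.b * M.P₀.prob A + M.c) 1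

end VBM

/-- `(P, Q)` is a conditional probability on the events and the events conditional on `B`: `P` gives
the unconditional probabilities, `Q E` is the probability of `E ∣ B`, and the product rule holds.
If `P.prob B = 0`, then `Q` is any probability concentrated on `B` (as for conditional probabilities
in the sense of de Finetti). -/
def IsCondProb {Ω : Type*} (B : Set Ω) (P Q : FinAddProb Ω) : Prop :=
  Q.prob B = 1 ∧ ∀ E, P.prob (E ∩ B) = Q.prob E * P.prob B

/-- The values at `A ∣ B` of all conditional probabilities in the credal set of the lower
probability `l`, i.e. of those that dominate `l`. -/
def credalValues {Ω : Type*} (l : Set Ω → ℝ) (A B : Set Ω) : Set ℝ :=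
  {x | ∃ P Q : FinAddProb Ω, (∀ E, l E ≤ P.prob E) ∧ IsCondProb B P Q ∧ Q.prob A = x}

namespace VBM

variable {Ω : Type*} (M : VBM Ω)

/-- The lower natural extension to `A ∣ B`: the lower envelope of the credal set. -/
noncomputable def lowerExt (A B : Set Ω) : ℝ := sInf (credalValues M.lower A B)

/-- The upper natural extension to `A ∣ B`: the upper envelope of the credal set. -/
noncomputable def upperExt (A B : Set Ω) : ℝ := sSup (credalValues M.lower A B)

/-- The partition `𝔅` weakly dilates the event `A`. -/
def WeaklyDilates (𝔅 : Set (Set Ω)) (A : Set Ω) : Prop :=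
  ∀ B ∈ 𝔅, M.lowerExt A B ≤ M.lower A ∧ M.lower A ≤ M.upper A ∧ M.upper A ≤ M.upperExt A B

/-- `A` is extreme: its precise probability is `0` or `1`. -/
def IsExtreme (A : Set Ω) : Prop :=
  (M.lower A = 0 ∧ M.upper A = 0) ∨ (M.lower A = 1 ∧ M.upper A = 1)

end VBM

/-- The partition `𝔅'` is coarser than (or equal to) the partition `𝔅`. -/
def IsCoarser {Ω : Type*} (𝔅' 𝔅 : Set (Set Ω)) : Prop :=
  ∀ B ∈ 𝔅, ∃ B' ∈ 𝔅', B ⊆ B'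

/-! ### Finitely additive probabilities: rescaling and conditioning -/

namespace FinAddProb

variable {Ω : Type*} (P : FinAddProb Ω)

/-! When `M.lower A > 0`, the closed form `lowerExt_eq` makes the lower dilation inequality at `B`
linear: since `a + c = 1 - b`, it reads `F B ≤ F univ` for the additive set function `F = M.excess
A`. Conjugacy turns the upper inequality into `G B ≤ G univ` with `G = M.excess Aᶜ`. Both totals are
nonnegative, and a vanishing lower probability makes its inequality automatic (`lowerExt_le_zero`).
The rest is combinatorial (`exists_merge_le`). If some block has `F, G ≥ 0`, merging all the others
keeps both bounds. If none has, a block with `F ≥ 0` has `G < 0`, a block with `G ≥ 0` has `F < 0`,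
and these two can be merged. With at least three blocks, either merging is nontrivial and proper. -/

theorem prob_empty : P.prob ∅ = 0 := by
  have h := P.add_of_disjoint ∅ ∅ (by simp)
  rw [Set.union_empty] at h
  linarith

theorem prob_inter_add_inter_compl (E S : Set Ω) :
    P.prob (E ∩ S) + P.prob (E ∩ Sᶜ) = P.prob E := by
  rw [← P.add_of_disjoint _ _ (Disjoint.mono Set.inter_subset_right Set.inter_subset_right
    disjoint_compl_right), Set.inter_union_compl]

theorem prob_compl (E : Set Ω) : P.prob Eᶜ = 1 - P.prob E := by
  have h := P.prob_inter_add_inter_compl Set.univ E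
  rw [Set.univ_inter, Set.univ_inter, P.univ_eq_one] at h
  linarith

theorem prob_mono {E F : Set Ω} (h : E ⊆ F) : P.prob E ≤ P.prob F := by
  have h₁ := P.prob_inter_add_inter_compl F E
  rw [Set.inter_eq_right.2 h] at h₁
  linarith [P.nonneg (F ∩ Eᶜ)]

theorem prob_le_one (E : Set Ω) : P.prob E ≤ 1 :=
  P.univ_eq_one ▸ P.prob_mono (Set.subset_univ E)

/-- The probability obtained by rescaling `P` by `r` on `S` and by `s` off `S`, and adding a point
mass `t` at `x`. -/
noncomputable def rescale (S : Set Ω) (r s t : ℝ) (x : Ω) (hr : 0 ≤ r) (hs : 0 ≤ s) (ht : 0 ≤ t)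
    (h : r * P.prob S + s * P.prob Sᶜ + t = 1) : FinAddProb Ω where
  prob E := r * P.prob (E ∩ S) + s * P.prob (E ∩ Sᶜ) + t * E.indicator 1 x
  nonneg E := by
    have h₁ : (0 : ℝ) ≤ E.indicator 1 x := Set.indicator_nonneg (by simp) x
    have h₂ := P.nonneg (E ∩ S)
    have h₃ := P.nonneg (E ∩ Sᶜ)
    positivity
  univ_eq_one := by simpa using h
  add_of_disjoint E F hEF := by
    rw [Set.union_inter_distrib_right, Set.union_inter_distrib_right,
      P.add_of_disjoint _ _ (hEF.mono Set.inter_subset_left Set.inter_subset_left),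
      P.add_of_disjoint _ _ (hEF.mono Set.inter_subset_left Set.inter_subset_left),
      Set.indicator_union_of_disjoint hEF]
    ring

/-- Conditioning on an event of positive probability. -/
noncomputable def condOn (B : Set Ω) (hB : 0 < P.prob B) : FinAddProb Ω where
  prob E := P.prob (E ∩ B) / P.prob B
  nonneg E := div_nonneg (P.nonneg _) hB.le
  univ_eq_one := by rw [Set.univ_inter, div_self hB.ne']
  add_of_disjoint E F hEF := by
    rw [Set.union_inter_distrib_right,
      P.add_of_disjoint _ _ (hEF.mono Set.inter_subset_left Set.inter_subset_left), add_div]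

theorem isCondProb_condOn (B : Set Ω) (hB : 0 < P.prob B) : IsCondProb B P (P.condOn B hB) := by
  refine ⟨?_, fun E => ?_⟩
  · simp [condOn, hB.ne']
  · simp [condOn, hB.ne']

end FinAddProb

theorem sum_of_additive_on_sets {Ω : Type*} {F : Set Ω → ℝ} (h₀ : F ∅ = 0)
    (hF : ∀ E G, Disjoint E G → F (E ∪ G) = F E + F G) (T : Finset (Set Ω))
    (hT : (T : Set (Set Ω)).PairwiseDisjoint id) : F (⋃₀ (T : Set (Set Ω))) = ∑ B ∈ T, F B := by
  classical
  induction T using Finset.induction_on with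
  | empty => simpa using h₀
  | insert B T hB ih =>
    rw [Finset.coe_insert] at hT
    rw [Finset.coe_insert, Set.sUnion_insert, Finset.sum_insert hB, hF, ih (hT.subset (by simp))]
    rw [Set.disjoint_sUnion_right]
    exact fun C hC => hT (by simp) (by simp [hC]) (fun h => hB (h ▸ hC))

theorem credalValues_mem_Icc {Ω : Type*} {l : Set Ω → ℝ} {A B : Set Ω} {x : ℝ}
    (hx : x ∈ credalValues l A B) : x ∈ Set.Icc 0 1 := by
  obtain ⟨P, Q, -, -, rfl⟩ := hx
  exact ⟨Q.nonneg A, Q.prob_le_one A⟩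

theorem credalValues_compl {Ω : Type*} (l : Set Ω → ℝ) {A B : Set Ω} {x : ℝ}
    (hx : x ∈ credalValues l A B) : 1 - x ∈ credalValues l Aᶜ B := by
  obtain ⟨P, Q, hP, hQ, rfl⟩ := hx
  exact ⟨P, Q, hP, hQ, Q.prob_compl A⟩

/-! ### The model, its dominating probabilities and its natural extensions -/

namespace VBM

variable {Ω : Type*} (M : VBM Ω)

theorem c_nonneg : 0 ≤ M.c := by
  have := M.add_le_one
  unfold c; linarith

theorem slope_prob_mono {E F : Set Ω} (h : E ⊆ F) : M.b * M.P₀.prob E ≤ M.b * M.P₀.prob F :=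
  mul_le_mul_of_nonneg_left (M.P₀.prob_mono h) M.b_pos.le

theorem slope_prob_add_le_one (E : Set Ω) : M.b * M.P₀.prob E + M.a ≤ 1 := by
  have h := M.slope_prob_mono (Set.subset_univ E)
  rw [M.P₀.univ_eq_one] at h
  linarith [M.add_le_one]

theorem lower_nonneg (E : Set Ω) : 0 ≤ M.lower E := by
  unfold lower; split_ifs <;> simp

theorem le_lower (E : Set Ω) : M.b * M.P₀.prob E + M.a ≤ M.lower E := by
  unfold lower; split_ifs
  · exact M.slope_prob_add_le_one E
  · exact le_max_left _ _

theorem lower_eq {E : Set Ω} (hE : E ≠ Set.univ) (h : 0 < M.lower E) :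
    M.lower E = M.b * M.P₀.prob E + M.a := by
  unfold lower at *
  rw [if_neg hE] at *
  rcases lt_max_iff.1 h with h | h
  · exact max_eq_left h.le
  · exact absurd h (lt_irrefl _)

theorem lower_mono {E F : Set Ω} (h : E ⊆ F) : M.lower E ≤ M.lower F := by
  unfold lower
  split_ifs with h₁ h₂ h₂
  · exact le_rfl
  · exact absurd (Set.univ_subset_iff.1 (h₁ ▸ h)) h₂
  · exact max_le (M.slope_prob_add_le_one E) zero_le_one
  · exact max_le_max (by linarith [M.slope_prob_mono h]) le_rfl

theorem upper_eq_one_sub (A : Set Ω) : M.upper A = 1 - M.lower Aᶜ := by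
  unfold upper lower
  by_cases h : A = ∅
  · simp [h]
  · rw [if_neg h, if_neg (by simpa using h), M.P₀.prob_compl, sub_eq_add_neg, ← min_neg_neg,
      ← min_add_add_left]
    unfold c
    congr 1 <;> ring

theorem lower_empty_of_nonempty [Nonempty Ω] : M.lower ∅ = 0 := by
  unfold lower
  rw [if_neg (Set.empty_ne_univ), M.P₀.prob_empty]
  simpa using M.a_nonpos

theorem nonempty_of_upper_pos {E : Set Ω} (h : 0 < M.upper E) : E.Nonempty := by
  rw [Set.nonempty_iff_ne_empty]
  rintro rfl
  simp [upper] at h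

theorem ne_univ_of_not_isExtreme [Nonempty Ω] {A : Set Ω} (h : ¬ M.IsExtreme A) :
    A ≠ Set.univ ∧ A ≠ ∅ := by
  have h₀ := M.lower_empty_of_nonempty
  have h₁ : M.lower Set.univ = 1 := by simp [lower]
  constructor
  · rintro rfl
    exact h (Or.inr ⟨h₁, by simp [upper_eq_one_sub, h₀]⟩)
  · rintro rfl
    exact h (Or.inl ⟨h₀, by simp [upper_eq_one_sub, h₁]⟩)

/-- The rescaled reference probabilities with point mass `c` dominate the lower probability. -/
theorem lower_le_rescale (S : Set Ω) (r s : ℝ) (x : Ω) (hr : 0 ≤ r) (hs : 0 ≤ s)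
    (h : r * M.P₀.prob S + s * M.P₀.prob Sᶜ + M.c = 1) (hr' : r ≤ M.b) (hs' : s ≤ M.b)
    (E : Set Ω) : M.lower E ≤ (M.P₀.rescale S r s M.c x hr hs M.c_nonneg h).prob E := by
  by_cases hE : E = Set.univ
  · rw [hE, FinAddProb.univ_eq_one]; simp [lower]
  unfold lower
  rw [if_neg hE]
  refine max_le ?_ (FinAddProb.nonneg _ _)
  change _ ≤ r * M.P₀.prob (E ∩ S) + s * M.P₀.prob (E ∩ Sᶜ) + M.c * E.indicator 1 x
  have h₁ : 0 ≤ M.c * E.indicator 1 x :=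
    mul_nonneg M.c_nonneg (Set.indicator_nonneg (by simp) x)
  have h₂ := M.P₀.prob_inter_add_inter_compl E S
  have h₃ := M.P₀.prob_compl S
  -- Relative to `b * P₀`, the mass removed from `E` is at most the total mass removed, `b - (a + b)
  -- = -a`.
  have h₄ := mul_le_mul_of_nonneg_left
    (M.P₀.prob_mono (Set.inter_subset_right : E ∩ S ⊆ S)) (sub_nonneg.2 hr')
  have h₅ := mul_le_mul_of_nonneg_left
    (M.P₀.prob_mono (Set.inter_subset_right : E ∩ Sᶜ ⊆ Sᶜ)) (sub_nonneg.2 hs')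
  have h₆ : M.b * M.P₀.prob E = M.b * M.P₀.prob (E ∩ S) + M.b * M.P₀.prob (E ∩ Sᶜ) := by
    rw [← h₂]; ring
  have h₇ : M.b * M.P₀.prob S + M.b * M.P₀.prob Sᶜ = M.b := by rw [h₃]; ring
  unfold c at h
  linarith

theorem mem_credalValues_of_dominates {P : FinAddProb Ω} (hP : ∀ E, M.lower E ≤ P.prob E)
    (A : Set Ω) {B : Set Ω} (hB : 0 < M.lower B) :
    P.prob (A ∩ B) / P.prob B ∈ credalValues M.lower A B :=
  ⟨P, P.condOn B (hB.trans_le (hP B)), hP, P.isCondProb_condOn B _, rfl⟩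

theorem credalValues_nonempty [Nonempty Ω] (A : Set Ω) {B : Set Ω} (hB : 0 < M.lower B) :
    (credalValues M.lower A B).Nonempty := by
  obtain ⟨x⟩ := ‹Nonempty Ω›
  exact ⟨_, M.mem_credalValues_of_dominates (M.lower_le_rescale ∅ 0 (M.a + M.b) x le_rfl
    M.add_nonneg (by simp [M.P₀.univ_eq_one, c]) M.b_pos.le (by linarith [M.a_nonpos])) A hB⟩

theorem lowerExt_le_of_mem {A B : Set Ω} {x : ℝ} (hx : x ∈ credalValues M.lower A B) :
    M.lowerExt A B ≤ x :=
  csInf_le ⟨0, fun _ hy => (credalValues_mem_Icc hy).1⟩ hx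

theorem upperExt_eq_one_sub [Nonempty Ω] (A : Set Ω) {B : Set Ω} (hB : 0 < M.lower B) :
    M.upperExt A B = 1 - M.lowerExt Aᶜ B := by
  apply le_antisymm
  · refine csSup_le (M.credalValues_nonempty A hB) fun x hx => ?_
    linarith [M.lowerExt_le_of_mem (credalValues_compl _ hx)]
  · have h : 1 - M.upperExt A B ≤ M.lowerExt Aᶜ B := by
      refine le_csInf (M.credalValues_nonempty Aᶜ hB) fun x hx => ?_
      have h₁ := credalValues_compl _ hx
      rw [compl_compl] at h₁
      have h₂ : 1 - x ≤ M.upperExt A B :=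
        le_csSup ⟨1, fun _ hy => (credalValues_mem_Icc hy).2⟩ h₁
      linarith
    linarith

/-- Some dominating probability gives `A ∩ B` mass zero: `b * P₀ (A ∩ B) ≤ -a` allows all its mass
to be removed, and the point mass `c` can sit outside `A`. -/
theorem lowerExt_le_zero {A B : Set Ω} (hA : A ≠ Set.univ) (hA₀ : M.lower A = 0)
    (hB : 0 < M.lower B) : M.lowerExt A B ≤ 0 := by
  obtain ⟨x, hx⟩ := (Set.ne_univ_iff_exists_notMem A).1 hA
  have hS : M.b * M.P₀.prob (A ∩ B) + M.a ≤ 0 := by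
    linarith [M.le_lower A, M.slope_prob_mono (Set.inter_subset_left : A ∩ B ⊆ A)]
  have hD := M.P₀.prob_compl (A ∩ B)
  have hD₀ := M.P₀.nonneg (A ∩ B)ᶜ
  have hle : M.a + M.b ≤ M.b * M.P₀.prob (A ∩ B)ᶜ := by rw [hD]; linarith
  have hs : (M.a + M.b) / M.P₀.prob (A ∩ B)ᶜ * M.P₀.prob (A ∩ B)ᶜ = M.a + M.b := by
    -- If the complement is null, `hle` forces `a + b = 0`, which agrees with division by zero.
    rcases hD₀.eq_or_lt with h | h
    · rw [← h] at hle ⊢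
      linarith [M.add_nonneg]
    · exact div_mul_cancel₀ _ h.ne'
  have hP := M.lower_le_rescale (A ∩ B) 0 ((M.a + M.b) / M.P₀.prob (A ∩ B)ᶜ) x le_rfl
    (div_nonneg M.add_nonneg hD₀) (by rw [hs]; simp [c]) M.b_pos.le
    (div_le_of_le_mul₀ hD₀ M.b_pos.le hle)
  refine (M.lowerExt_le_of_mem (M.mem_credalValues_of_dominates hP A hB)).trans_eq ?_
  rw [div_eq_zero_iff]
  left
  simp [FinAddProb.rescale, hx, M.P₀.prob_empty]

/-- The closed form of the lower natural extension in the regular case. -/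
theorem lowerExt_eq {A B : Set Ω} (hAB : 0 < M.b * M.P₀.prob (A ∩ B) + M.a)
    (hne : (Aᶜ ∩ B).Nonempty) (hB : 0 < M.lower B) :
    M.lowerExt A B =
      (M.b * M.P₀.prob (A ∩ B) + M.a) / (M.b * M.P₀.prob B + M.a + M.c) := by
  have hsplit : ∀ P : FinAddProb Ω, P.prob B = P.prob (A ∩ B) + P.prob (Aᶜ ∩ B) := fun P => by
    rw [← P.prob_inter_add_inter_compl B A, Set.inter_comm B, Set.inter_comm B]
  have hq : 0 ≤ M.b * M.P₀.prob (Aᶜ ∩ B) + M.c :=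
    _root_.add_nonneg (mul_nonneg M.b_pos.le (M.P₀.nonneg _)) M.c_nonneg
  have hden : M.b * M.P₀.prob B + M.a + M.c =
      (M.b * M.P₀.prob (A ∩ B) + M.a) + (M.b * M.P₀.prob (Aᶜ ∩ B) + M.c) := by
    rw [hsplit]; ring
  obtain ⟨x, hxA, hxB⟩ := id hne
  apply le_antisymm
  -- Attained by removing the whole loss `-a` from `A ∩ B` and placing `c` at a point of `Aᶜ ∩ B`.
  · have hp₀ : 0 < M.P₀.prob (A ∩ B) := by
      by_contra h
      have h₁ : M.P₀.prob (A ∩ B) = 0 := le_antisymm (not_lt.1 h) (M.P₀.nonneg _)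
      rw [h₁] at hAB
      linarith [M.a_nonpos]
    have hr := div_mul_cancel₀ (M.b * M.P₀.prob (A ∩ B) + M.a) hp₀.ne'
    have hP := M.lower_le_rescale (A ∩ B) ((M.b * M.P₀.prob (A ∩ B) + M.a) / M.P₀.prob (A ∩ B))
      M.b x (div_nonneg hAB.le hp₀.le) M.b_pos.le
      (by rw [hr, M.P₀.prob_compl]; unfold c; ring)
      (by rw [div_le_iff₀ hp₀]; linarith [M.a_nonpos]) le_rfl
    refine (M.lowerExt_le_of_mem (M.mem_credalValues_of_dominates hP A hB)).trans_eq ?_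
    have h₁ : Aᶜ ∩ B ∩ (A ∩ B) = ∅ := by ext; simp; tauto
    have h₂ : Aᶜ ∩ B ∩ (A ∩ B)ᶜ = Aᶜ ∩ B := by ext; simp; tauto
    have hxA' : x ∉ A := hxA
    rw [hden, hsplit (FinAddProb.rescale ..)]
    simp only [FinAddProb.rescale, h₁, h₂, Set.inter_self, Set.inter_compl_self,
      M.P₀.prob_empty, hr]
    simp [hxA', hxB]
  · have : Nonempty Ω := ⟨x⟩
    refine le_csInf (M.credalValues_nonempty A hB) ?_
    rintro _ ⟨P, Q, hP, ⟨-, hQ⟩, rfl⟩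
    have hPB := hB.trans_le (hP B)
    have h₁ : M.b * M.P₀.prob (A ∩ B) + M.a ≤ P.prob (A ∩ B) := (M.le_lower _).trans (hP _)
    have h₂ : P.prob (Aᶜ ∩ B) ≤ M.b * M.P₀.prob (Aᶜ ∩ B) + M.c := by
      have h₃ := (M.le_lower _).trans (hP (Aᶜ ∩ B)ᶜ)
      rw [P.prob_compl, M.P₀.prob_compl] at h₃
      unfold c; linarith
    have h₃ : Q.prob A = P.prob (A ∩ B) / P.prob B := by rw [hQ, mul_div_cancel_right₀ _ hPB.ne']
    rw [h₃, hden, div_le_div_iff₀ (by linarith) hPB, hsplit P]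
    -- `p / (p + q)` increases in `p` and decreases in `q`.
    have h₄ := mul_le_mul h₁ h₂ (P.nonneg _) (P.nonneg _)
    linarith

/-! ### Linearising weak dilation -/

/-- The excess of `A ∩ B` over its share `M.lower A` of `B`, set to zero if `M.lower A = 0`. -/
noncomputable def excess (A B : Set Ω) : ℝ :=
  open Classical in
  if M.lower A = 0 then 0 else M.b * (M.P₀.prob (A ∩ B) - M.lower A * M.P₀.prob B)

theorem excess_empty (A : Set Ω) : M.excess A ∅ = 0 := by
  simp [excess, M.P₀.prob_empty]

theorem excess_union (A : Set Ω) {E F : Set Ω} (h : Disjoint E F) :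
    M.excess A (E ∪ F) = M.excess A E + M.excess A F := by
  unfold excess
  split_ifs
  · simp
  · rw [Set.inter_union_distrib_left, M.P₀.add_of_disjoint _ _ h,
      M.P₀.add_of_disjoint _ _ (h.mono Set.inter_subset_right Set.inter_subset_right)]
    ring

theorem excess_univ_nonneg {A : Set Ω} (hA : A ≠ Set.univ) : 0 ≤ M.excess A Set.univ := by
  unfold excess
  split_ifs with h
  · exact le_rfl
  · rw [Set.inter_univ, M.P₀.univ_eq_one,
      M.lower_eq hA (lt_of_le_of_ne (M.lower_nonneg A) (Ne.symm h))]
    refine mul_nonneg M.b_pos.le ?_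
    -- With `p = P₀ A`: `p - (b * p + a) = p * (1 - (a + b)) + (1 - p) * (-a)`.
    nlinarith [mul_nonneg (M.P₀.nonneg A) (sub_nonneg.2 M.add_le_one),
      mul_nonneg (sub_nonneg.2 (M.P₀.prob_le_one A)) (neg_nonneg.2 M.a_nonpos)]

/-- The lower half of weak dilation, expressed through the excess. -/
theorem lowerExt_le_lower_iff {A B : Set Ω} (hA : A ≠ Set.univ) (hB : 0 < M.lower B)
    (h : M.lower A = 0 ∨ 0 < M.lower (A ∩ B) ∧ (Aᶜ ∩ B).Nonempty) :
    M.lowerExt A B ≤ M.lower A ↔ M.excess A B ≤ M.excess A Set.univ := by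
  by_cases h₀ : M.lower A = 0
  · simp [excess, h₀, M.lowerExt_le_zero hA h₀ hB]
  obtain ⟨h₁, h₂⟩ := h.resolve_left h₀
  have h₃ : A ∩ B ≠ Set.univ := fun h => hA (Set.univ_subset_iff.1 (h ▸ Set.inter_subset_left))
  rw [M.lower_eq h₃ h₁] at h₁
  have h₄ := M.lower_eq hA (lt_of_le_of_ne (M.lower_nonneg A) (Ne.symm h₀))
  have h₅ : 0 < M.b * M.P₀.prob B + M.a + M.c := by
    linarith [M.slope_prob_mono (Set.inter_subset_right : A ∩ B ⊆ B), M.c_nonneg]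
  rw [M.lowerExt_eq h₁ h₂ hB, div_le_iff₀ h₅]
  unfold excess
  rw [if_neg h₀, if_neg h₀, Set.inter_univ, M.P₀.univ_eq_one]
  have h₆ : M.lower A * (M.b * M.P₀.prob B + M.a + M.c) =
      M.b * (M.lower A * M.P₀.prob B) + M.lower A * (1 - M.b) := by unfold c; ring
  rw [h₆]
  constructor <;> intro h₇ <;> linarith

end VBM

/-! ### Merging blocks, and the theorem -/

/-- Merging the blocks of a nontrivial proper subfamily of a partition. -/
theorem isPartition_merge {Ω : Type*} {𝔅 T : Set (Set Ω)} (h𝔅 : Setoid.IsPartition 𝔅)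
    (hT : T ⊆ 𝔅) (hT₂ : T.Nontrivial) (hne : T ≠ 𝔅) :
    Setoid.IsPartition (insert (⋃₀ T) (𝔅 \ T)) ∧ insert (⋃₀ T) (𝔅 \ T) ≠ {Set.univ} ∧
      insert (⋃₀ T) (𝔅 \ T) ≠ 𝔅 ∧ IsCoarser (insert (⋃₀ T) (𝔅 \ T)) 𝔅 := by
  have huniq : ∀ {B C : Set Ω} {x : Ω}, B ∈ 𝔅 → C ∈ 𝔅 → x ∈ B → x ∈ C → B = C :=
    fun hB hC hx hx' => (h𝔅.2 _).unique ⟨hB, hx⟩ ⟨hC, hx'⟩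
  have hnon : ∀ B ∈ 𝔅, B.Nonempty := fun B hB => Setoid.nonempty_of_mem_partition h𝔅 hB
  obtain ⟨B, hB, C, hC, hBC⟩ := hT₂
  obtain ⟨x, hx⟩ := hnon B (hT hB)
  refine ⟨⟨?_, fun y => ?_⟩, fun h => ?_, fun h => ?_, fun D hD => ?_⟩
  · rintro (h | h)
    · exact (h ▸ Set.mem_sUnion_of_mem hx hB : x ∈ (∅ : Set Ω))
    · exact h𝔅.1 h.1
  · obtain ⟨D, ⟨hD, hy⟩, -⟩ := h𝔅.2 y
    by_cases hDT : D ∈ T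
    · refine ⟨⋃₀ T, ⟨Set.mem_insert _ _, D, hDT, hy⟩, ?_⟩
      rintro E ⟨rfl | hE, hyE⟩
      · rfl
      · exact absurd (huniq hE.1 hD hyE hy ▸ hDT) hE.2
    · refine ⟨D, ⟨Or.inr ⟨hD, hDT⟩, hy⟩, ?_⟩
      rintro E ⟨rfl | hE, hyE⟩
      · obtain ⟨G, hG, hyG⟩ := hyE
        exact absurd (huniq (hT hG) hD hyG hy ▸ hG) hDT
      · exact huniq hE.1 hD hyE hy
  · obtain ⟨D, hD, hDT⟩ := Set.exists_of_ssubset (hT.ssubset_of_ne hne)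
    have h₁ : D ∈ ({Set.univ} : Set (Set Ω)) := h ▸ Or.inr ⟨hD, hDT⟩
    have h₂ : x ∈ D := by rw [Set.mem_singleton_iff.1 h₁]; trivial
    exact hDT (huniq hD (hT hB) h₂ hx ▸ hB)
  · have h₁ : ⋃₀ T ∈ 𝔅 := h ▸ Set.mem_insert _ _
    obtain ⟨y, hy⟩ := hnon C (hT hC)
    exact hBC ((huniq (hT hB) h₁ hx ⟨B, hB, hx⟩).trans
      (huniq h₁ (hT hC) ⟨C, hC, hy⟩ hy))
  · by_cases hDT : D ∈ T
    · exact ⟨⋃₀ T, Set.mem_insert _ _, Set.subset_sUnion_of_mem hDT⟩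
    · exact ⟨D, Or.inr ⟨hD, hDT⟩, subset_rfl⟩

/-- If two additive set functions have nonnegative totals and are bounded on the blocks by their
totals, then some nontrivial proper merging of blocks preserves the bounds. -/
theorem exists_merge_le {Ω : Type*} {𝔅 : Set (Set Ω)} (h𝔅 : Setoid.IsPartition 𝔅)
    (hfin : 𝔅.Finite) (hcard : 3 ≤ 𝔅.ncard) {F G : Set Ω → ℝ} (hF₀ : F ∅ = 0) (hG₀ : G ∅ = 0)
    (hF : ∀ D E, Disjoint D E → F (D ∪ E) = F D + F E)
    (hG : ∀ D E, Disjoint D E → G (D ∪ E) = G D + G E)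
    (hFu : 0 ≤ F Set.univ) (hGu : 0 ≤ G Set.univ)
    (hFle : ∀ B ∈ 𝔅, F B ≤ F Set.univ) (hGle : ∀ B ∈ 𝔅, G B ≤ G Set.univ) :
    ∃ T ⊆ 𝔅, T.Nontrivial ∧ T ≠ 𝔅 ∧ F (⋃₀ T) ≤ F Set.univ ∧ G (⋃₀ T) ≤ G Set.univ := by
  have hex : ∀ H : Set Ω → ℝ, H ∅ = 0 → (∀ D E, Disjoint D E → H (D ∪ E) = H D + H E) →
      0 ≤ H Set.univ → ∃ B ∈ 𝔅, 0 ≤ H B := by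
    intro H h₀ hH hHu
    by_contra! hneg
    have h₁ := sum_of_additive_on_sets h₀ hH hfin.toFinset (by
      rw [hfin.coe_toFinset]; exact h𝔅.pairwiseDisjoint)
    rw [hfin.coe_toFinset, h𝔅.sUnion_eq_univ] at h₁
    have hne : hfin.toFinset.Nonempty := by
      rw [Set.Finite.toFinset_nonempty, ← Set.ncard_pos hfin]; omega
    have h₂ : ∑ B ∈ hfin.toFinset, H B < 0 :=
      Finset.sum_neg (fun B hB => hneg B (hfin.mem_toFinset.1 hB)) hne
    linarith
  by_cases hboth : ∃ B ∈ 𝔅, 0 ≤ F B ∧ 0 ≤ G B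
  · obtain ⟨B, hB, hFB, hGB⟩ := hboth
    have hunion : B ∪ ⋃₀ (𝔅 \ {B}) = Set.univ := by
      rw [← Set.sUnion_insert, Set.insert_sdiff_singleton, Set.insert_eq_of_mem hB,
        h𝔅.sUnion_eq_univ]
    have hdisj : Disjoint B (⋃₀ (𝔅 \ {B})) := by
      rw [Set.disjoint_sUnion_right]
      exact fun C hC => h𝔅.pairwiseDisjoint hB hC.1 (Ne.symm hC.2)
    refine ⟨𝔅 \ {B}, Set.sdiff_subset, ?_, fun h => (h.ge hB).2 rfl, ?_, ?_⟩
    · rw [← Set.one_lt_ncard_iff_nontrivial_and_finite.trans (and_iff_left (hfin.sdiff)),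
        Set.ncard_sdiff_singleton_of_mem hB]
      omega
    · rw [← hunion, hF _ _ hdisj]; linarith
    · rw [← hunion, hG _ _ hdisj]; linarith
  · push Not at hboth
    obtain ⟨B, hB, hFB⟩ := hex F hF₀ hF hFu
    obtain ⟨C, hC, hGC⟩ := hex G hG₀ hG hGu
    have hGB := hboth B hB hFB
    have hFC : F C < 0 := by
      by_contra h
      exact absurd hGC (not_le.2 (hboth C hC (not_lt.1 h)))
    have hBC : B ≠ C := by rintro rfl; linarith
    have hdisj : Disjoint B C := h𝔅.pairwiseDisjoint hB hC hBC
    refine ⟨{B, C}, by rintro _ (rfl | rfl) <;> assumption, Set.nontrivial_pair hBC, ?_, ?_, ?_⟩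
    · intro h
      rw [← h, Set.ncard_pair hBC] at hcard
      omega
    · rw [Set.sUnion_pair, hF _ _ hdisj]; linarith [hFle B hB]
    · rw [Set.sUnion_pair, hG _ _ hdisj]; linarith [hGle C hC]

theorem theorem1 {Ω : Type*} (M : VBM Ω) (𝔅 : Set (Set Ω)) (A : Set Ω)
    (hpart : Setoid.IsPartition 𝔅) (hfin : 𝔅.Finite) (hcard : 3 ≤ 𝔅.ncard)
    (hdil : M.WeaklyDilates 𝔅 A) (hA : ¬ M.IsExtreme A)
    (hpos : ∀ B ∈ 𝔅, 0 < M.lower B)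
    (ha : M.lower A = 0 ∨ ∀ B ∈ 𝔅, 0 < M.lower (A ∩ B) ∧ 0 < M.upper (Aᶜ ∩ B))
    (hb : M.upper A = 1 ∨ ∀ B ∈ 𝔅, 0 < M.lower (Aᶜ ∩ B) ∧ 0 < M.upper (A ∩ B)) :
    ∃ 𝔅' : Set (Set Ω), Setoid.IsPartition 𝔅' ∧ 𝔅' ≠ {Set.univ} ∧ 𝔅' ≠ 𝔅 ∧
      IsCoarser 𝔅' 𝔅 ∧ M.WeaklyDilates 𝔅' A := by
  have hne : 𝔅.Nonempty := by rw [← Set.ncard_pos hfin]; omega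
  obtain ⟨B₀, hB₀⟩ := hne
  have : Nonempty Ω := (Setoid.nonempty_of_mem_partition hpart hB₀).to_type
  obtain ⟨hAu, hAe⟩ := M.ne_univ_of_not_isExtreme hA
  have hAu' : Aᶜ ≠ Set.univ := by simpa using hAe
  have hdual : ∀ B, 0 < M.lower B →
      (M.upper A ≤ M.upperExt A B ↔ M.lowerExt Aᶜ B ≤ M.lower Aᶜ) := fun B hB => by
    rw [M.upper_eq_one_sub, M.upperExt_eq_one_sub A hB, sub_le_sub_iff_left]
  -- The regularity conditions pass to supersets of a block, so the linear criterion serves both the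
  -- blocks and their unions.
  have hreg : ∀ B ∈ 𝔅, ∀ D, B ⊆ D →
      (M.lowerExt A D ≤ M.lower A ↔ M.excess A D ≤ M.excess A Set.univ) ∧
      (M.upper A ≤ M.upperExt A D ↔ M.excess Aᶜ D ≤ M.excess Aᶜ Set.univ) := by
    intro B hB D hBD
    have hD := (hpos B hB).trans_le (M.lower_mono hBD)
    refine ⟨M.lowerExt_le_lower_iff hAu hD (ha.imp_right fun h => ?_),
      (hdual D hD).trans (M.lowerExt_le_lower_iff hAu' hD ?_)⟩
    · exact ⟨(h B hB).1.trans_le (M.lower_mono (Set.inter_subset_inter_right A hBD)),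
        (M.nonempty_of_upper_pos (h B hB).2).mono (Set.inter_subset_inter_right _ hBD)⟩
    · refine hb.imp (fun h => ?_) fun h => ?_
      · rw [M.upper_eq_one_sub] at h
        linarith
      · rw [compl_compl]
        exact ⟨(h B hB).1.trans_le (M.lower_mono (Set.inter_subset_inter_right _ hBD)),
          (M.nonempty_of_upper_pos (h B hB).2).mono (Set.inter_subset_inter_right _ hBD)⟩
  obtain ⟨T, hT, hT₂, hTne, hTA, hTA'⟩ := exists_merge_le hpart hfin hcard
    (M.excess_empty A) (M.excess_empty Aᶜ) (fun _ _ => M.excess_union A)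
    (fun _ _ => M.excess_union Aᶜ) (M.excess_univ_nonneg hAu) (M.excess_univ_nonneg hAu')
    (fun B hB => (hreg B hB B subset_rfl).1.1 (hdil B hB).1)
    (fun B hB => (hreg B hB B subset_rfl).2.1 (hdil B hB).2.2)
  obtain ⟨h₁, h₂, h₃, h₄⟩ := isPartition_merge hpart hT hT₂ hTne
  refine ⟨_, h₁, h₂, h₃, h₄, ?_⟩
  rintro D (rfl | hD)
  · obtain ⟨B, hB⟩ := hT₂.nonempty
    have h := hreg B (hT hB) (⋃₀ T) (Set.subset_sUnion_of_mem hB)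
    exact ⟨h.1.2 hTA, (hdil B₀ hB₀).2.1, h.2.2 hTA'⟩
  · exact hdil D hD.1
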